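/- Let $Y$ and $\psi$ be real random variables on a probability space with $\mathbb{E}|Y|<\infty$ and $\mathbb{E}|\psi|<\infty$. Let $F_Y$ and $F_\psi$ be their cumulative distribution functions, write $x^+=\max(0,x)$, and put $$\Delta(y)=\int_{-\infty}^{y}\bigl(F_Y(t)-F_\psi(t)\bigr)\,dt ,\qquad y\in\mathbb{R}.$$ Then $F_Y-F_\psi$ is integrable on $(-\infty,y]$ for every $y\in\mathbb{R}$, so that $\Delta$ is well defined, and the following three statements are equivalent: (i) ($\mathrm{H}_0$) there exist random variables $Y'$ and $\psi'$ on some probability space, and a sub-$\sigma$-algebra $\mathcal{I}'$ of that space, such that $Y'$ has the same distribution as $Y$, $\psi'$ has the same distribution as $\psi$, $\sigma(\psi')\subseteq\mathcal{I}'$, and $\mathbb{E}[Y'\mid\mathcal{I}']=\psi'$ almost surely; (ii) ($F_Y$ is a mean-preserving spread of $F_\psi$) $\Delta(y)\ge 0$ for all $y\in\mathbb{R}$, and $\mathbb{E}[Y]=\mathbb{E}[\psi]$; (iii) $\mathbb{E}\bigl[(y-Y)^+-(y-\psi)^+\bigr]\ge 0$ for all $y\in\mathbb{R}$, and $\mathbb{E}[Y]=\mathbb{E}[\psi]$.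 -/

import Mathlib

open MeasureTheory ProbabilityTheory

universe u w

/-- The hypothesis `H₀` that rational expectations can be rationalized: on some probability space
`(Ω', m', P')` there are random variables `Y'`, `ψ'` with `Y' ∼ Y` and `ψ' ∼ ψ`, and a sub-σ-algebra
`I'` of `m'` with `σ(ψ') ⊆ I'`, such that `E[Y' | I'] = ψ'` almost surely. -/
def RationalizesRE {Ω : Type u} [MeasurableSpace Ω] (P : Measure Ω) (Y ψ : Ω → ℝ) : Prop :=
  ∃ (Ω' : Type w) (m' : MeasurableSpace Ω') (P' : Measure Ω') (Y' ψ' : Ω' → ℝ),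
    IsProbabilityMeasure P' ∧ Measurable Y' ∧ Measurable ψ' ∧
    IdentDistrib Y' Y P' P ∧ IdentDistrib ψ' ψ P' P ∧
    ∃ I' : MeasurableSpace Ω', I' ≤ m' ∧
      MeasurableSpace.comap ψ' inferInstance ≤ I' ∧
      P'[Y' | I'] =ᵐ[P'] ψ'

/-- `cdfDiff P Y ψ t = F_Y(t) - F_ψ(t)`, the difference of the cumulative distribution functions
of `Y` and `ψ` under `P`. -/
noncomputable def cdfDiff {Ω : Type u} [MeasurableSpace Ω] (P : Measure Ω) (Y ψ : Ω → ℝ)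
    (t : ℝ) : ℝ :=
  cdf (P.map Y) t - cdf (P.map ψ) t

/-- `Δ(y) = ∫_{-∞}^y (F_Y(t) - F_ψ(t)) dt`. -/
noncomputable def Delta {Ω : Type u} [MeasurableSpace Ω] (P : Measure Ω) (Y ψ : Ω → ℝ)
    (y : ℝ) : ℝ :=
  ∫ t in Set.Iic y, cdfDiff P Y ψ t

/-! By Tonelli, the integral of F_X over (-∞, y] is E(y - X)⁺, so (ii) and (iii) agree. Conditional
Jensen for x ↦ (y - x)⁺ gives (i) → (iii). The converse is Strassen's theorem on the line, proved by
an explicit construction.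

Let `a`, `b` be the quantile functions of `ψ`, `Y` on (0,1). Condition (iii) forces ∫₀ˣ (a - b) ≥ 0,
with equality at x = 1. Hence (a - b)⁺dt and (b - a)⁺dt have equal mass and the first lies to the
left of the second. Their comonotone coupling `Q` lives on pairs s ≤ t with b(s) < a(s) ≤ a(t) <
b(t). Start from the coupling (a, b) and let s and t exchange their `b` values on the mass dQ/(b(t)
- b(s)). The marginals are unchanged, while the drift b - a gains dQ at s and loses dQ at t, which
cancels it everywhere (`exists_martingale_coupling`). -/

/-! ### Quantile functions and comonotone coupling -/

/-- A quantile function of a finite measure `α` on `ℝ`, defined on `(0, α ℝ)`. -/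
theorem exists_quantile (α : Measure ℝ) [IsFiniteMeasure α] :
    ∃ q : ℝ → ℝ, Measurable q ∧
      (∀ t ∈ Set.Ioo 0 (α.real Set.univ), ∀ x, q t ≤ x ↔ ENNReal.ofReal t ≤ α (Set.Iic x)) ∧
      (volume.restrict (Set.Ioo 0 (α.real Set.univ))).map q = α := by
  classical
  set M := α.real Set.univ with hM
  let S : ℝ → Set ℝ := fun t => {x | ENNReal.ofReal t ≤ α (Set.Iic x)}
  let q : ℝ → ℝ := fun t => if t ∈ Set.Ioo 0 M then sInf (S t) else 0
  have hmono : ∀ x y, x ≤ y → α (Set.Iic x) ≤ α (Set.Iic y) := fun x y h =>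
    measure_mono (Set.Iic_subset_Iic.2 h)
  have hne : ∀ t ∈ Set.Ioo 0 M, (S t).Nonempty := by
    intro t ht
    have h1 : ENNReal.ofReal t < α Set.univ := by
      rw [ENNReal.ofReal_lt_iff_lt_toReal ht.1.le (measure_ne_top _ _)]
      exact ht.2
    obtain ⟨x, hx⟩ := ((tendsto_measure_Iic_atTop α).eventually (lt_mem_nhds h1)).exists
    exact ⟨x, hx.le⟩
  have hbot : Filter.Tendsto (fun x => α (Set.Iic x)) Filter.atBot (nhds 0) := by
    have := tendsto_measure_iInter_atBot (μ := α) (s := fun x : ℝ => Set.Iic x)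
      (fun _ => measurableSet_Iic.nullMeasurableSet) (fun _ _ h => Set.Iic_subset_Iic.2 h)
      ⟨0, measure_ne_top _ _⟩
    have h0 : (⋂ x : ℝ, Set.Iic x) = ∅ := by
      refine Set.eq_empty_of_forall_notMem fun y hy => ?_
      have := Set.mem_iInter.1 hy (y - 1)
      simp only [Set.mem_Iic] at this
      linarith
    rwa [h0, measure_empty] at this
  have hbdd : ∀ t ∈ Set.Ioo 0 M, BddBelow (S t) := by
    intro t ht
    have h1 : 0 < ENNReal.ofReal t := ENNReal.ofReal_pos.2 ht.1
    obtain ⟨y, hy⟩ := (hbot.eventually (gt_mem_nhds h1)).exists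
    refine ⟨y, fun x hx => ?_⟩
    by_contra! hlt
    exact absurd (hx.trans (hmono x y hlt.le)) (not_le.2 hy)
  have hgal : ∀ t ∈ Set.Ioo 0 M, ∀ x, q t ≤ x ↔ ENNReal.ofReal t ≤ α (Set.Iic x) := by
    intro t ht x
    simp only [q, if_pos ht]
    refine ⟨fun h => ?_, fun h => csInf_le (hbdd t ht) h⟩
    -- Right continuity of x ↦ α(-∞, x] shows that the infimum defining `q t` is attained.
    have hlim : Filter.Tendsto (α ∘ Set.Iic) (nhdsWithin x (Set.Ioi x))
        (nhds (α (⋂ r > x, Set.Iic r))) :=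
      tendsto_measure_biInter_gt (fun r _ => measurableSet_Iic.nullMeasurableSet)
        (fun i j _ hij => Set.Iic_subset_Iic.2 hij) ⟨x + 1, by simp, measure_ne_top _ _⟩
    have hI : (⋂ r > x, Set.Iic r) = Set.Iic x := by
      ext z
      simp only [Set.mem_iInter, Set.mem_Iic]
      exact ⟨fun hz => le_of_forall_gt_imp_ge_of_dense hz, fun hz r hr => hz.trans hr.le⟩
    rw [hI] at hlim
    refine ge_of_tendsto hlim ?_
    filter_upwards [self_mem_nhdsWithin] with r hr
    obtain ⟨s, hs, hsr⟩ := exists_lt_of_csInf_lt (hne t ht) (h.trans_lt hr)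
    exact le_trans hs (hmono s r hsr.le)
  have hgal' : ∀ t ∈ Set.Ioo 0 M, ∀ x, q t ≤ x ↔ t ≤ α.real (Set.Iic x) := by
    intro t ht x
    rw [hgal t ht, ENNReal.ofReal_le_iff_le_toReal (measure_ne_top _ _)]
    rfl
  have hmeas : Measurable q := by
    refine measurable_of_Iic fun x => ?_
    have : q ⁻¹' Set.Iic x = (Set.Ioo 0 M ∩ Set.Iic (α.real (Set.Iic x))) ∪
        ((Set.Ioo 0 M)ᶜ ∩ {_t | 0 ≤ x}) := by
      ext t
      by_cases ht : t ∈ Set.Ioo 0 M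
      · have := hgal' t ht x
        simp only [Set.mem_preimage, Set.mem_Iic, this, Set.mem_union, Set.mem_inter_iff, ht,
          Set.mem_compl_iff, true_and, not_true, false_and, or_false]
      · simp only [Set.mem_preimage, Set.mem_Iic, q, Set.mem_union, Set.mem_inter_iff, ht,
          Set.mem_compl_iff, true_and, not_false_eq_true, false_and, false_or, if_false,
          Set.mem_ofPred_eq]
    rw [this]
    exact (measurableSet_Ioo.inter measurableSet_Iic).union
      (measurableSet_Ioo.compl.inter (MeasurableSet.const _))
  refine ⟨q, hmeas, hgal, ?_⟩
  refine Measure.ext_of_Iic _ _ fun x => ?_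
  rw [Measure.map_apply hmeas measurableSet_Iic, Measure.restrict_apply (hmeas measurableSet_Iic)]
  have h1 : q ⁻¹' Set.Iic x ∩ Set.Ioo 0 M = Set.Ioo 0 M ∩ Set.Iic (α.real (Set.Iic x)) := by
    ext t
    simp only [Set.mem_inter_iff, Set.mem_preimage, Set.mem_Iic]
    exact ⟨fun h => ⟨h.2, (hgal' t h.2 x).1 h.1⟩, fun h => ⟨(hgal' t h.1 x).2 h.2, h.1⟩⟩
  -- Closing the right end covers the case where (-∞, x] carries all the mass `M`.
  have h2 : (Set.Ioo 0 M ∩ Set.Iic (α.real (Set.Iic x)) : Set ℝ) =ᵐ[volume]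
      (Set.Ioc 0 M ∩ Set.Iic (α.real (Set.Iic x)) : Set ℝ) :=
    Ioo_ae_eq_Ioc.inter (ae_eq_refl _)
  have hle : α.real (Set.Iic x) ≤ M := measureReal_mono (Set.subset_univ _)
  rw [h1, measure_congr h2, Set.Ioc_inter_Iic, min_eq_right hle, Real.volume_Ioc, sub_zero]
  exact ENNReal.ofReal_toReal (measure_ne_top _ _)

/-- The comonotone coupling of two measures on `ℝ` in stochastic order. -/
theorem exists_coupling_le_of_measure_Iic_le (α β : Measure ℝ) [IsFiniteMeasure α]
    [IsFiniteMeasure β] (huniv : α Set.univ = β Set.univ)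
    (hle : ∀ x, β (Set.Iic x) ≤ α (Set.Iic x)) :
    ∃ Q : Measure (ℝ × ℝ), Q.map Prod.fst = α ∧ Q.map Prod.snd = β ∧ ∀ᵐ p ∂Q, p.1 ≤ p.2 := by
  obtain ⟨q, hq, hqg, hqm⟩ := exists_quantile α
  obtain ⟨r, hr, hrg, hrm⟩ := exists_quantile β
  have hM : β.real Set.univ = α.real Set.univ := by simp only [Measure.real, huniv]
  rw [hM] at hrg hrm
  refine ⟨(volume.restrict (Set.Ioo 0 (α.real Set.univ))).map fun t => (q t, r t), ?_, ?_, ?_⟩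
  · rw [Measure.map_map measurable_fst (hq.prodMk hr)]
    exact hqm
  · rw [Measure.map_map measurable_snd (hq.prodMk hr)]
    exact hrm
  · rw [ae_map_iff (hq.prodMk hr).aemeasurable (measurableSet_le measurable_fst measurable_snd)]
    refine (ae_restrict_iff' measurableSet_Ioo).2 (Filter.Eventually.of_forall fun t ht => ?_)
    exact (hqg t ht _).2 (((hrg t ht _).1 le_rfl).trans (hle _))

/-! ### Martingale couplings and convex order -/

/-- A martingale coupling of the laws of `a` and `b` obtained by exchanging the values of `b`
along a coupling `Q` of the measures `(a - b)⁺ μ` and `(b - a)⁺ μ`. -/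
theorem exists_martingale_coupling {X : Type*} [MeasurableSpace X] {μ : Measure X}
    [IsFiniteMeasure μ] {a b : X → ℝ} (ha : Measurable a) (hb : Measurable b)
    (hai : Integrable a μ) (hbi : Integrable b μ) {Q : Measure (X × X)}
    (hQ₁ : Q.map Prod.fst = μ.withDensity fun x => ENNReal.ofReal (a x - b x))
    (hQ₂ : Q.map Prod.snd = μ.withDensity fun x => ENNReal.ofReal (b x - a x))
    (hQ : ∀ᵐ p ∂Q, a p.1 ≤ a p.2) :
    ∃ π : Measure (ℝ × ℝ), π.map Prod.fst = μ.map a ∧ π.map Prod.snd = μ.map b ∧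
      ∀ B : Set ℝ, MeasurableSet B →
        ∫ p in Prod.fst ⁻¹' B, p.2 ∂π = ∫ p in Prod.fst ⁻¹' B, p.1 ∂π := by
  have hab : Measurable fun x => ENNReal.ofReal (a x - b x) := (ha.sub hb).ennreal_ofReal
  have hba : Measurable fun x => ENNReal.ofReal (b x - a x) := (hb.sub ha).ennreal_ofReal
  have hfst : ∀ᵐ p ∂Q, b p.1 < a p.1 := by
    refine ae_of_ae_map (p := fun x => b x < a x) measurable_fst.aemeasurable ?_
    rw [hQ₁, ae_withDensity_iff hab]
    filter_upwards with x hx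
    simpa using hx
  have hsnd : ∀ᵐ p ∂Q, a p.2 < b p.2 := by
    refine ae_of_ae_map (p := fun x => a x < b x) measurable_snd.aemeasurable ?_
    rw [hQ₂, ae_withDensity_iff hba]
    filter_upwards with x hx
    simpa using hx
  let h : X × X → ℝ := fun p => b p.2 - b p.1
  have hh : Measurable h := (hb.comp measurable_snd).sub (hb.comp measurable_fst)
  have hpos : ∀ᵐ p ∂Q, 0 < h p := by
    filter_upwards [hfst, hsnd, hQ] with p h1 h2 h3
    simp only [h]; linarith
  -- Exchanging `b p.1` and `b p.2` on mass `τ` shifts drift by `h τ`; the weight 1/h makes this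
  -- shift exactly `Q`.
  let w : X × X → ENNReal := fun p => (ENNReal.ofReal (h p))⁻¹
  have hw : Measurable w := hh.ennreal_ofReal.inv
  let τ := Q.withDensity w
  have hRQ : τ.withDensity (fun p => ENNReal.ofReal (h p)) = Q := by
    have : τ.withDensity (fun p => ENNReal.ofReal (h p)) = Q.withDensity 1 := by
      rw [← withDensity_mul _ hw hh.ennreal_ofReal]
      refine withDensity_congr_ae ?_
      filter_upwards [hpos] with p hp
      exact ENNReal.inv_mul_cancel (by simpa using hp) ENNReal.ofReal_ne_top
    rw [this, withDensity_one]
  -- Since 1/h ≤ 1/c along `g`, the weight cancels the density `c` of the marginal of `Q`. Each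
  -- point is thus asked for no more mass than `μ` has there.
  have hmap : ∀ (g : X × X → X) (c : X → ℝ), Measurable g → Measurable c →
      (Q.map g = μ.withDensity fun x => ENNReal.ofReal (c x)) →
      (∀ᵐ p ∂Q, c (g p) ≤ h p) → τ.map g ≤ μ.restrict {x | 0 < c x} := by
    intro g c hg hc hQg hle
    have hc' : Measurable fun x => ENNReal.ofReal (c x) := hc.ennreal_ofReal
    refine Measure.le_iff.2 fun s hs => ?_
    have hcm : MeasurableSet {x | 0 < c x} := measurableSet_lt measurable_const hc
    calc τ.map g s = ∫⁻ p in g ⁻¹' s, w p ∂Q := by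
          rw [Measure.map_apply hg hs, withDensity_apply _ (hg hs)]
      _ ≤ ∫⁻ p in g ⁻¹' s, (ENNReal.ofReal (c (g p)))⁻¹ ∂Q := by
          refine lintegral_mono_ae (ae_restrict_of_ae ?_)
          filter_upwards [hle] with p hp
          exact ENNReal.inv_le_inv.2 (ENNReal.ofReal_le_ofReal hp)
      _ = ∫⁻ x in s, (ENNReal.ofReal (c x))⁻¹ ∂(Q.map g) :=
          (setLIntegral_map (f := fun x => (ENNReal.ofReal (c x))⁻¹) hs hc'.inv hg).symm
      _ = ∫⁻ x in s, ENNReal.ofReal (c x) * (ENNReal.ofReal (c x))⁻¹ ∂μ := by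
          rw [hQg, restrict_withDensity hs, lintegral_withDensity_eq_lintegral_mul _ hc'
            (g := fun x => (ENNReal.ofReal (c x))⁻¹) hc'.inv]
          rfl
      _ ≤ ∫⁻ x in s, ({x | 0 < c x}.indicator 1 x) ∂μ := by
          refine lintegral_mono fun x => ?_
          by_cases hx : 0 < c x
          · simp [Set.indicator, hx, ENNReal.mul_inv_le_one]
          · simp [Set.indicator, hx, ENNReal.ofReal_of_nonpos (not_lt.1 hx)]
      _ = μ.restrict {x | 0 < c x} s := by
          rw [lintegral_indicator_one hcm, Measure.restrict_apply hcm, Measure.restrict_apply hs,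
            Set.inter_comm]
  have hR₁ := hmap Prod.fst (fun x => a x - b x) measurable_fst (ha.sub hb) hQ₁ (by
    filter_upwards [hfst, hsnd, hQ] with p h1 h2 h3
    simp only [h]; linarith)
  have hR₂ := hmap Prod.snd (fun x => b x - a x) measurable_snd (hb.sub ha) hQ₂ (by
    filter_upwards [hfst, hsnd, hQ] with p h1 h2 h3
    simp only [h]; linarith)
  -- The two marginals live on the disjoint sets {b < a} and {a < b}.
  have hR : τ.map Prod.fst + τ.map Prod.snd ≤ μ := by
    refine (add_le_add hR₁ hR₂).trans ?_
    rw [← Measure.restrict_union (t := {x | 0 < b x - a x}) _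
      (measurableSet_lt measurable_const (hb.sub ha))]
    · exact Measure.restrict_le_self
    · refine Set.disjoint_left.2 fun x hx hx' => ?_
      simp only [Set.mem_ofPred_eq] at hx hx'
      linarith
  have hR₁' : τ.map Prod.fst ≤ μ := hR₁.trans Measure.restrict_le_self
  have hR₂' : τ.map Prod.snd ≤ μ := hR₂.trans Measure.restrict_le_self
  -- As 1/h may be unbounded, finiteness comes from domination by `μ`.
  have : IsFiniteMeasure (τ.map Prod.fst) := isFiniteMeasure_of_le μ hR₁'
  have : IsFiniteMeasure (τ.map Prod.snd) := isFiniteMeasure_of_le μ hR₂'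
  let ρ := μ - (τ.map Prod.fst + τ.map Prod.snd)
  have hρ : ρ + (τ.map Prod.fst + τ.map Prod.snd) = μ := Measure.sub_add_cancel_of_le hR
  let e₀ : X → ℝ × ℝ := fun x => (a x, b x)
  let e₁ : X × X → ℝ × ℝ := fun p => (a p.1, b p.2)
  let e₂ : X × X → ℝ × ℝ := fun p => (a p.2, b p.1)
  have he₀ : Measurable e₀ := ha.prodMk hb
  have he₁ : Measurable e₁ := (ha.comp measurable_fst).prodMk (hb.comp measurable_snd)
  have he₂ : Measurable e₂ := (ha.comp measurable_snd).prodMk (hb.comp measurable_fst)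
  -- The mass `ρ` untouched by the exchange keeps its pair (a, b); the rest swaps partners.
  set π := ρ.map e₀ + (τ.map e₁ + τ.map e₂) with hπ
  have hπ₁ : π.map Prod.fst = μ.map a := by
    conv_rhs => rw [← hρ]
    simp only [hπ, Measure.map_add _ _ measurable_fst, Measure.map_add _ _ ha,
      Measure.map_map measurable_fst he₀, Measure.map_map measurable_fst he₁,
      Measure.map_map measurable_fst he₂, Measure.map_map ha measurable_fst,
      Measure.map_map ha measurable_snd]
    rfl
  have hπ₂ : π.map Prod.snd = μ.map b := by
    conv_rhs => rw [← hρ, add_comm (τ.map Prod.fst)]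
    simp only [hπ, Measure.map_add _ _ measurable_snd, Measure.map_add _ _ hb,
      Measure.map_map measurable_snd he₀, Measure.map_map measurable_snd he₁,
      Measure.map_map measurable_snd he₂, Measure.map_map hb measurable_fst,
      Measure.map_map hb measurable_snd]
    rfl
  refine ⟨π, hπ₁, hπ₂, fun B hB => ?_⟩
  have hi₁ : Integrable (fun p : ℝ × ℝ => p.1) π :=
    (integrable_map_measure (g := id) aestronglyMeasurable_id measurable_fst.aemeasurable).1 <| by
      rw [hπ₁]
      exact (integrable_map_measure aestronglyMeasurable_id ha.aemeasurable).2 hai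
  have hi₂ : Integrable (fun p : ℝ × ℝ => p.2) π :=
    (integrable_map_measure (g := id) aestronglyMeasurable_id measurable_snd.aemeasurable).1 <| by
      rw [hπ₂]
      exact (integrable_map_measure aestronglyMeasurable_id hb.aemeasurable).2 hbi
  rw [← sub_eq_zero, ← integral_sub hi₂.integrableOn hi₁.integrableOn]
  set A := a ⁻¹' B
  have hA : MeasurableSet A := ha hB
  have hB' : MeasurableSet (Prod.fst ⁻¹' B : Set (ℝ × ℝ)) := measurable_fst hB
  have hcomp : ∀ {f : X → ℝ}, Measurable f → Integrable f μ →
      Integrable (fun p => f p.1) τ ∧ Integrable (fun p => f p.2) τ := fun hf hfi =>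
    ⟨(integrable_map_measure hf.aestronglyMeasurable measurable_fst.aemeasurable).1
        (hfi.mono_measure hR₁'),
      (integrable_map_measure hf.aestronglyMeasurable measurable_snd.aemeasurable).1
        (hfi.mono_measure hR₂')⟩
  obtain ⟨ha₁, ha₂⟩ := hcomp ha hai
  obtain ⟨hb₁, hb₂⟩ := hcomp hb hbi
  have hdm : Measurable fun p : ℝ × ℝ => p.2 - p.1 := measurable_snd.sub measurable_fst
  have hd : Integrable (fun p : ℝ × ℝ => p.2 - p.1) π := hi₂.sub hi₁
  have hd₀ := (integrable_add_measure.1 hd).1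
  have hd₁ := (integrable_add_measure.1 (integrable_add_measure.1 hd).2).1
  have hd₂ := (integrable_add_measure.1 (integrable_add_measure.1 hd).2).2
  have hsplit : ∫ p in Prod.fst ⁻¹' B, (p.2 - p.1) ∂π =
      ∫ x in A, (b x - a x) ∂ρ + (∫ p in Prod.fst ⁻¹' A, (b p.2 - a p.1) ∂τ +
        ∫ p in Prod.snd ⁻¹' A, (b p.1 - a p.2) ∂τ) := by
    rw [hπ, Measure.restrict_add, Measure.restrict_add,
      integral_add_measure hd₀.restrict (hd₁.restrict.add_measure hd₂.restrict),
      integral_add_measure hd₁.restrict hd₂.restrict,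
      setIntegral_map hB' hdm.aestronglyMeasurable he₀.aemeasurable,
      setIntegral_map hB' hdm.aestronglyMeasurable he₁.aemeasurable,
      setIntegral_map hB' hdm.aestronglyMeasurable he₂.aemeasurable]
    rfl
  have hbam : Measurable fun x => b x - a x := hb.sub ha
  have hbai : Integrable (fun x => b x - a x) μ := hbi.sub hai
  have hμsplit : ∫ x in A, (b x - a x) ∂μ =
      ∫ x in A, (b x - a x) ∂ρ + (∫ p in Prod.fst ⁻¹' A, (b p.1 - a p.1) ∂τ +
        ∫ p in Prod.snd ⁻¹' A, (b p.2 - a p.2) ∂τ) := by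
    have h₀ : Integrable (fun x => b x - a x) ρ := hbai.mono_measure Measure.sub_le
    have h₁ := hbai.mono_measure hR₁'
    have h₂ := hbai.mono_measure hR₂'
    conv_lhs => rw [← hρ]
    rw [Measure.restrict_add, Measure.restrict_add,
      integral_add_measure h₀.restrict (h₁.restrict.add_measure h₂.restrict),
      integral_add_measure h₁.restrict h₂.restrict,
      setIntegral_map hA hbam.aestronglyMeasurable measurable_fst.aemeasurable,
      setIntegral_map hA hbam.aestronglyMeasurable measurable_snd.aemeasurable]
  have hRpos : ∀ᵐ p ∂τ, 0 ≤ h p :=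
    (withDensity_absolutelyContinuous Q w).ae_le (hpos.mono fun p hp => hp.le)
  have hRh : ∀ s : Set (X × X), MeasurableSet s → ∫ p in s, h p ∂τ = Q.real s := by
    intro s hs
    rw [integral_eq_lintegral_of_nonneg_ae (ae_restrict_of_ae hRpos) hh.aestronglyMeasurable,
      ← withDensity_apply _ hs, hRQ]
    rfl
  have hQA₁ : Q.real (Prod.fst ⁻¹' A) = (∫⁻ x in A, ENNReal.ofReal (a x - b x) ∂μ).toReal := by
    rw [← withDensity_apply _ hA, ← hQ₁, Measure.map_apply measurable_fst hA]
    rfl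
  have hQA₂ : Q.real (Prod.snd ⁻¹' A) = (∫⁻ x in A, ENNReal.ofReal (b x - a x) ∂μ).toReal := by
    rw [← withDensity_apply _ hA, ← hQ₂, Measure.map_apply measurable_snd hA]
    rfl
  -- The drift of the original coupling over `A`, which the exchange terms `h₁` and `h₂` below
  -- cancel.
  have hμA : ∫ x in A, (b x - a x) ∂μ = Q.real (Prod.snd ⁻¹' A) - Q.real (Prod.fst ⁻¹' A) := by
    rw [integral_eq_lintegral_pos_part_sub_lintegral_neg_part hbai.integrableOn, hQA₁, hQA₂]
    simp only [neg_sub]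
  have hhi : Integrable h τ := hb₂.sub hb₁
  have hba₁ : Integrable (fun p => b p.1 - a p.1) τ := hb₁.sub ha₁
  have hba₂ : Integrable (fun p => b p.2 - a p.2) τ := hb₂.sub ha₂
  have h₁ : ∫ p in Prod.fst ⁻¹' A, (b p.2 - a p.1) ∂τ =
      ∫ p in Prod.fst ⁻¹' A, (b p.1 - a p.1) ∂τ + Q.real (Prod.fst ⁻¹' A) := by
    rw [← hRh _ (measurable_fst hA), ← integral_add hba₁.integrableOn hhi.integrableOn]
    refine integral_congr_ae (Filter.Eventually.of_forall fun p => ?_)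
    simp only [h]; ring
  have h₂ : ∫ p in Prod.snd ⁻¹' A, (b p.1 - a p.2) ∂τ =
      ∫ p in Prod.snd ⁻¹' A, (b p.2 - a p.2) ∂τ - Q.real (Prod.snd ⁻¹' A) := by
    rw [← hRh _ (measurable_snd hA), ← integral_sub hba₂.integrableOn hhi.integrableOn]
    refine integral_congr_ae (Filter.Eventually.of_forall fun p => ?_)
    simp only [h]; ring
  rw [hsplit, h₁, h₂]
  linarith

/-- Strassen's theorem on the line: probability measures `μ ≤ ν` in the convex order admit a
martingale coupling. -/
theorem exists_martingale_coupling_of_convex_order (μ ν : Measure ℝ) [IsProbabilityMeasure μ]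
    [IsProbabilityMeasure ν] (hμ : Integrable (fun x => x) μ) (hν : Integrable (fun x => x) ν)
    (hle : ∀ y, ∫ x, max 0 (y - x) ∂μ ≤ ∫ x, max 0 (y - x) ∂ν)
    (hmean : ∫ x, x ∂μ = ∫ x, x ∂ν) :
    ∃ π : Measure (ℝ × ℝ), π.map Prod.fst = μ ∧ π.map Prod.snd = ν ∧
      ∀ B : Set ℝ, MeasurableSet B →
        ∫ p in Prod.fst ⁻¹' B, p.2 ∂π = ∫ p in Prod.fst ⁻¹' B, p.1 ∂π := by
  obtain ⟨a, ha, hag, ham⟩ := exists_quantile μ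
  obtain ⟨b, hb, hbg, hbm⟩ := exists_quantile ν
  rw [probReal_univ] at hag ham hbg hbm
  set I : Set ℝ := Set.Ioo 0 1
  set l : Measure ℝ := volume.restrict I
  have hlI : ∀ᵐ x ∂l, x ∈ I := ae_restrict_mem measurableSet_Ioo
  have hmono : ∀ {η : Measure ℝ} {q : ℝ → ℝ},
      (∀ t ∈ I, ∀ x, q t ≤ x ↔ ENNReal.ofReal t ≤ η (Set.Iic x)) → MonotoneOn q I :=
    fun hq s hs t ht hst => (hq s hs _).2 <|
      (ENNReal.ofReal_le_ofReal hst).trans ((hq t ht _).1 le_rfl)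
  have hai : Integrable a l := (integrable_map_measure
    (f := a) (g := fun x => x) aestronglyMeasurable_id ha.aemeasurable).1 (by rwa [ham])
  have hbi : Integrable b l := (integrable_map_measure
    (f := b) (g := fun x => x) aestronglyMeasurable_id hb.aemeasurable).1 (by rwa [hbm])
  have hmean' : ∫ t, a t ∂l = ∫ t, b t ∂l := by
    rw [← ham, ← hbm, integral_map ha.aemeasurable measurable_id'.aestronglyMeasurable,
      integral_map hb.aemeasurable measurable_id'.aestronglyMeasurable] at hmean
    exact hmean
  have hle' : ∀ y, ∫ t, max 0 (y - a t) ∂l ≤ ∫ t, max 0 (y - b t) ∂l := by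
    intro y
    have hm : Measurable fun x : ℝ => max 0 (y - x) := by fun_prop
    have := hle y
    rwa [← ham, ← hbm, integral_map ha.aemeasurable hm.aestronglyMeasurable,
      integral_map hb.aemeasurable hm.aestronglyMeasurable] at this
  have habi : Integrable (fun t => a t - b t) l := hai.sub hbi
  set α := l.withDensity fun t => ENNReal.ofReal (a t - b t) with hα
  set β := l.withDensity fun t => ENNReal.ofReal (b t - a t) with hβ
  have : IsFiniteMeasure α := isFiniteMeasure_withDensity_ofReal habi.2
  have : IsFiniteMeasure β := isFiniteMeasure_withDensity_ofReal (hbi.sub hai).2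
  have hdiff : ∀ s, MeasurableSet s → ∫ t in s, (a t - b t) ∂l = α.real s - β.real s := by
    intro s hs
    rw [integral_eq_lintegral_pos_part_sub_lintegral_neg_part habi.integrableOn,
      measureReal_def, measureReal_def, hα, hβ, withDensity_apply _ hs, withDensity_apply _ hs]
    simp only [neg_sub]
  -- Test the order at y = b(x): by monotonicity (b(x) - b)⁺ is supported on t ≤ x, whereas
  -- restricting (b(x) - a)⁺ to t ≤ x and dropping the positive part only lowers its integral.
  have hnonneg : ∀ x, 0 ≤ ∫ t in Set.Iic x, (a t - b t) ∂l := by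
    intro x
    rcases le_or_gt x 0 with hx0 | hx0
    · rw [setIntegral_measure_zero]
      rw [Measure.restrict_apply measurableSet_Iic, show Set.Iic x ∩ I = ∅ from
        Set.eq_empty_of_forall_notMem fun t ht => (ht.1.trans hx0).not_gt ht.2.1, measure_empty]
    rcases le_or_gt 1 x with hx1 | hx1
    · rw [Measure.restrict_eq_self_of_ae_mem (s := Set.Iic x)
        (hlI.mono fun t ht => ht.2.le.trans hx1),
        integral_sub hai hbi, hmean', sub_self]
    have hxI : x ∈ I := ⟨hx0, hx1⟩
    have hya : Integrable (fun t => b x - a t) l := (integrable_const _).sub hai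
    have hyb : Integrable (fun t => b x - b t) l := (integrable_const _).sub hbi
    have hya' : Integrable (fun t => max 0 (b x - a t)) l := (integrable_const _).sup hya
    have h1 : ∫ t, max 0 (b x - b t) ∂l = ∫ t in Set.Iic x, (b x - b t) ∂l := by
      rw [← integral_indicator measurableSet_Iic]
      refine integral_congr_ae ?_
      filter_upwards [hlI] with t ht
      by_cases htx : t ≤ x
      · rw [Set.indicator_of_mem (by exact htx)]
        exact max_eq_right (sub_nonneg.2 (hmono hbg ht hxI htx))
      · rw [Set.indicator_of_notMem (by exact htx)]
        exact max_eq_left (sub_nonpos.2 (hmono hbg hxI ht (not_le.1 htx).le))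
    have h2 : ∫ t in Set.Iic x, (b x - a t) ∂l ≤ ∫ t, max 0 (b x - a t) ∂l :=
      (integral_mono hya.restrict hya'.restrict fun t => le_max_right _ _).trans
        (setIntegral_le_integral hya' (Filter.Eventually.of_forall fun t => le_max_left _ _))
    have h3 : ∫ t in Set.Iic x, (a t - b t) ∂l =
        ∫ t in Set.Iic x, (b x - b t) ∂l - ∫ t in Set.Iic x, (b x - a t) ∂l := by
      rw [← integral_sub hyb.restrict hya.restrict]
      refine integral_congr_ae (Filter.Eventually.of_forall fun t => ?_)
      simp only; ring
    linarith [hle' (b x)]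
  have huniv : α Set.univ = β Set.univ := by
    rw [← ENNReal.toReal_eq_toReal_iff' (measure_ne_top _ _) (measure_ne_top _ _), ← sub_eq_zero]
    refine (hdiff _ MeasurableSet.univ).symm.trans ?_
    rw [setIntegral_univ, integral_sub hai hbi, hmean', sub_self]
  have hIic : ∀ x, β (Set.Iic x) ≤ α (Set.Iic x) := by
    intro x
    rw [← ENNReal.toReal_le_toReal (measure_ne_top _ _) (measure_ne_top _ _), ← sub_nonneg]
    exact (hnonneg x).trans_eq (hdiff _ measurableSet_Iic)
  obtain ⟨Q, hQ₁, hQ₂, hQ⟩ := exists_coupling_le_of_measure_Iic_le α β huniv hIic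
  have hI₁ : ∀ᵐ p ∂Q, p.1 ∈ I := by
    refine ae_of_ae_map (p := fun x => x ∈ I) measurable_fst.aemeasurable ?_
    rw [hQ₁]
    exact withDensity_absolutelyContinuous _ _ hlI
  have hI₂ : ∀ᵐ p ∂Q, p.2 ∈ I := by
    refine ae_of_ae_map (p := fun x => x ∈ I) measurable_snd.aemeasurable ?_
    rw [hQ₂]
    exact withDensity_absolutelyContinuous _ _ hlI
  have hQa : ∀ᵐ p ∂Q, a p.1 ≤ a p.2 := by
    filter_upwards [hQ, hI₁, hI₂] with p h h₁ h₂ using hmono hag h₁ h₂ h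
  obtain ⟨π, h₁, h₂, h₃⟩ := exists_martingale_coupling ha hb hai hbi hQ₁ hQ₂ hQa
  exact ⟨π, h₁.trans ham, h₂.trans hbm, h₃⟩

/-! ### Integrated distribution functions -/

/-- Tonelli on {x ≤ t ≤ y}, whose slice at fixed x has length (y - x)⁺. -/
theorem lintegral_Iic_cdf (ν : Measure ℝ) [IsProbabilityMeasure ν] (y : ℝ) :
    ∫⁻ t in Set.Iic y, ENNReal.ofReal (cdf ν t) = ∫⁻ x, ENNReal.ofReal (y - x) ∂ν := by
  have hmeas : MeasurableSet {p : ℝ × ℝ | p.2 ≤ p.1} :=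
    measurableSet_le measurable_snd measurable_fst
  calc ∫⁻ t in Set.Iic y, ENNReal.ofReal (cdf ν t)
      = ∫⁻ t in Set.Iic y, ∫⁻ x, {p : ℝ × ℝ | p.2 ≤ p.1}.indicator 1 (t, x) ∂ν := by
        refine lintegral_congr fun t => ?_
        rw [ofReal_cdf, ← lintegral_indicator_one measurableSet_Iic]
        rfl
    _ = ∫⁻ x, (∫⁻ t in Set.Iic y, {p : ℝ × ℝ | p.2 ≤ p.1}.indicator 1 (t, x)) ∂ν :=
        lintegral_lintegral_swap
          (f := fun t x => {p : ℝ × ℝ | p.2 ≤ p.1}.indicator 1 (t, x))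
          (measurable_one.indicator hmeas).aemeasurable
    _ = ∫⁻ x, ENNReal.ofReal (y - x) ∂ν := by
        refine lintegral_congr fun x => ?_
        rw [← Real.volume_Icc, ← Set.Ici_inter_Iic, ← Measure.restrict_apply measurableSet_Ici,
          ← lintegral_indicator_one measurableSet_Ici]
        rfl

theorem integrableOn_Iic_cdf {ν : Measure ℝ} [IsProbabilityMeasure ν]
    (hν : Integrable (fun x => x) ν) (y : ℝ) : IntegrableOn (fun t => cdf ν t) (Set.Iic y) := by
  refine ⟨(monotone_cdf ν).measurable.aestronglyMeasurable, ?_⟩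
  rw [hasFiniteIntegral_iff_ofReal (Filter.Eventually.of_forall fun t => cdf_nonneg ν t),
    lintegral_Iic_cdf]
  have hi : Integrable (fun x => y - x) ν := (integrable_const y).sub hν
  exact hi.lintegral_lt_top

theorem setIntegral_Iic_cdf {ν : Measure ℝ} [IsProbabilityMeasure ν] (y : ℝ) :
    ∫ t in Set.Iic y, cdf ν t = ∫ x, max 0 (y - x) ∂ν := by
  have hm : Measurable fun x : ℝ => max 0 (y - x) := by fun_prop
  rw [integral_eq_lintegral_of_nonneg_ae (Filter.Eventually.of_forall fun t => cdf_nonneg ν t)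
    (monotone_cdf ν).measurable.aestronglyMeasurable, lintegral_Iic_cdf,
    integral_eq_lintegral_of_nonneg_ae (f := fun x => max 0 (y - x))
      (Filter.Eventually.of_forall fun x => le_max_left _ _) hm.aestronglyMeasurable]
  refine congrArg ENNReal.toReal (lintegral_congr fun x => ?_)
  rw [ENNReal.ofReal_max, ENNReal.ofReal_zero, max_eq_right zero_le]

/-! ### Conditional expectations and couplings -/

/-- Conditional Jensen by hand: on the `m`-measurable event {ψ ≤ y}, `ψ` and `Y` have the same
integral, and y - Y ≤ (y - Y)⁺. -/
theorem integral_max_sub_le_of_condExp_eq {Ω : Type*} {m mΩ : MeasurableSpace Ω} {P : Measure Ω}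
    [IsFiniteMeasure P] {Y ψ : Ω → ℝ} (hm : m ≤ mΩ) (hY : Integrable Y P) (hψ : Integrable ψ P)
    (hψm : Measurable[m] ψ) (h : P[Y | m] =ᵐ[P] ψ) (y : ℝ) :
    ∫ ω, max 0 (y - ψ ω) ∂P ≤ ∫ ω, max 0 (y - Y ω) ∂P := by
  have hs : MeasurableSet[m] (ψ ⁻¹' Set.Iic y) := hψm measurableSet_Iic
  have hyY : Integrable (fun ω => y - Y ω) P := (integrable_const y).sub hY
  have hyY' : Integrable (fun ω => max 0 (y - Y ω)) P := (integrable_const _).sup hyY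
  have hset : ∫ ω in ψ ⁻¹' Set.Iic y, ψ ω ∂P = ∫ ω in ψ ⁻¹' Set.Iic y, Y ω ∂P := by
    rw [← setIntegral_condExp hm hY hs]
    exact integral_congr_ae (ae_restrict_of_ae h.symm)
  calc ∫ ω, max 0 (y - ψ ω) ∂P = ∫ ω in ψ ⁻¹' Set.Iic y, (y - ψ ω) ∂P := by
        rw [← integral_indicator (hm _ hs)]
        refine integral_congr_ae (Filter.Eventually.of_forall fun ω => ?_)
        by_cases hω : ψ ω ≤ y
        · simp [Set.indicator, hω]
        · simp [Set.indicator, hω, (not_le.1 hω).le]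
    _ = ∫ ω in ψ ⁻¹' Set.Iic y, (y - Y ω) ∂P := by
        rw [integral_sub (integrable_const y) hψ.restrict, hset,
          ← integral_sub (integrable_const y) hY.restrict]
    _ ≤ ∫ ω in ψ ⁻¹' Set.Iic y, max 0 (y - Y ω) ∂P :=
        integral_mono hyY.restrict hyY'.restrict fun ω => le_max_right _ _
    _ ≤ ∫ ω, max 0 (y - Y ω) ∂P :=
        setIntegral_le_integral hyY' (Filter.Eventually.of_forall fun ω => le_max_left _ _)

/-- The coordinates of the plane serve as ψ' and Y', with I' = σ(ψ'). `ULift` only moves the plane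
to the universe `w`. -/
theorem rationalizesRE_of_coupling {Ω : Type u} [MeasurableSpace Ω] {P : Measure Ω}
    [IsProbabilityMeasure P] {Y ψ : Ω → ℝ} (hY : Integrable Y P) (hψ : Integrable ψ P)
    {π : Measure (ℝ × ℝ)} (h₁ : π.map Prod.fst = P.map ψ) (h₂ : π.map Prod.snd = P.map Y)
    (h : ∀ B : Set ℝ, MeasurableSet B →
      ∫ p in Prod.fst ⁻¹' B, p.2 ∂π = ∫ p in Prod.fst ⁻¹' B, p.1 ∂π) :
    RationalizesRE.{u, w} P Y ψ := by
  have hup : Measurable (ULift.up.{w} : ℝ × ℝ → _) := measurable_up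
  have hdown : Measurable (ULift.down.{w} : _ → ℝ × ℝ) := measurable_down
  set P' : Measure (ULift.{w} (ℝ × ℝ)) := π.map ULift.up with hP'
  set Y' : ULift.{w} (ℝ × ℝ) → ℝ := fun z => z.down.2 with hY'
  set ψ' : ULift.{w} (ℝ × ℝ) → ℝ := fun z => z.down.1 with hψ'
  have hYm : Measurable Y' := measurable_snd.comp hdown
  have hψm : Measurable ψ' := measurable_fst.comp hdown
  have hprob : IsProbabilityMeasure π := by
    have : IsProbabilityMeasure (π.map Prod.fst) := by
      rw [h₁]
      exact Measure.isProbabilityMeasure_map hψ.aemeasurable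
    exact Measure.isProbabilityMeasure_of_map Prod.fst
  have hprob' : IsProbabilityMeasure P' := Measure.isProbabilityMeasure_map hup.aemeasurable
  have hidY : IdentDistrib Y' Y P' P := by
    refine ⟨hYm.aemeasurable, hY.aemeasurable, ?_⟩
    rw [hP', Measure.map_map hYm hup]
    exact h₂
  have hidψ : IdentDistrib ψ' ψ P' P := by
    refine ⟨hψm.aemeasurable, hψ.aemeasurable, ?_⟩
    rw [hP', Measure.map_map hψm hup]
    exact h₁
  have hYi : Integrable Y' P' := hidY.integrable_iff.2 hY
  have hψi : Integrable ψ' P' := hidψ.integrable_iff.2 hψ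
  refine ⟨_, _, P', Y', ψ', hprob', hYm, hψm, hidY, hidψ,
    MeasurableSpace.comap ψ' inferInstance, hψm.comap_le, le_rfl, ?_⟩
  -- Every set of σ(ψ') is a preimage of a Borel `B`, so `h` is the defining property of the
  -- conditional expectation.
  refine (ae_eq_condExp_of_forall_setIntegral_eq hψm.comap_le hYi
    (fun s _ _ => hψi.integrableOn) ?_ ?_).symm
  · rintro s ⟨B, hB, rfl⟩ -
    rw [hP', setIntegral_map (hψm hB) hψm.aestronglyMeasurable hup.aemeasurable,
      setIntegral_map (hψm hB) hYm.aestronglyMeasurable hup.aemeasurable]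
    exact (h B hB).symm
  · exact (comap_measurable ψ').stronglyMeasurable.aestronglyMeasurable

/-! ### The equivalence -/

theorem theorem1 {Ω : Type u} [MeasurableSpace Ω] (P : Measure Ω) [IsProbabilityMeasure P]
    (Y ψ : Ω → ℝ) (hY : Integrable Y P) (hψ : Integrable ψ P) :
    (∀ y : ℝ, IntegrableOn (cdfDiff P Y ψ) (Set.Iic y)) ∧
    List.TFAE [
      RationalizesRE.{u, w} P Y ψ,
      (∀ y : ℝ, 0 ≤ Delta P Y ψ y) ∧ ∫ ω, Y ω ∂P = ∫ ω, ψ ω ∂P,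
      (∀ y : ℝ, 0 ≤ ∫ ω, (max 0 (y - Y ω) - max 0 (y - ψ ω)) ∂P) ∧
        ∫ ω, Y ω ∂P = ∫ ω, ψ ω ∂P] := by
  have hpY : IsProbabilityMeasure (P.map Y) := Measure.isProbabilityMeasure_map hY.aemeasurable
  have hpψ : IsProbabilityMeasure (P.map ψ) := Measure.isProbabilityMeasure_map hψ.aemeasurable
  have hiY : Integrable (fun x => x) (P.map Y) :=
    (integrable_map_measure aestronglyMeasurable_id hY.aemeasurable).2 hY
  have hiψ : Integrable (fun x => x) (P.map ψ) :=
    (integrable_map_measure aestronglyMeasurable_id hψ.aemeasurable).2 hψ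
  have hmax : ∀ y : ℝ, Measurable fun x : ℝ => max 0 (y - x) := fun y => by fun_prop
  have hmaxi : ∀ {X : Ω → ℝ}, Integrable X P → ∀ y, Integrable (fun ω => max 0 (y - X ω)) P :=
    fun hX y => (integrable_const (0 : ℝ)).sup ((integrable_const y).sub hX)
  have hsub : ∀ y, ∫ ω, (max 0 (y - Y ω) - max 0 (y - ψ ω)) ∂P =
      ∫ ω, max 0 (y - Y ω) ∂P - ∫ ω, max 0 (y - ψ ω) ∂P := fun y =>
    integral_sub (hmaxi hY y) (hmaxi hψ y)
  have hDelta : ∀ y, Delta P Y ψ y = ∫ ω, (max 0 (y - Y ω) - max 0 (y - ψ ω)) ∂P := by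
    intro y
    rw [hsub, ← integral_map hY.aemeasurable (hmax y).aestronglyMeasurable,
      ← integral_map hψ.aemeasurable (hmax y).aestronglyMeasurable,
      ← setIntegral_Iic_cdf, ← setIntegral_Iic_cdf]
    exact integral_sub (integrableOn_Iic_cdf hiY y) (integrableOn_Iic_cdf hiψ y)
  refine ⟨fun y => (integrableOn_Iic_cdf hiY y).sub (integrableOn_Iic_cdf hiψ y), ?_⟩
  tfae_have 2 ↔ 3 := by simp only [hDelta]
  tfae_have 1 → 3 := by
    rintro ⟨Ω', m', P', Y', ψ', hP', hYm, hψm, hidY, hidψ, hI⟩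
    have hYi : Integrable Y' P' := hidY.integrable_iff.2 hY
    have hψi : Integrable ψ' P' := hidψ.integrable_iff.2 hψ
    have hYy := fun y => (hidY.comp (hmax y)).integral_eq
    have hψy := fun y => (hidψ.comp (hmax y)).integral_eq
    simp only [Function.comp_def] at hYy hψy
    have hYE := hidY.integral_eq
    have hψE := hidψ.integral_eq
    obtain ⟨I', hI', hcomap, hcond⟩ := hI
    refine ⟨fun y => ?_, ?_⟩
    · rw [hsub, sub_nonneg, ← hYy, ← hψy]
      exact integral_max_sub_le_of_condExp_eq hI' hYi hψi (measurable_iff_comap_le.2 hcomap)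
        hcond y
    · rw [← hYE, ← hψE]
      exact (integral_condExp hI').symm.trans (integral_congr_ae hcond)
  tfae_have 3 → 1 := by
    rintro ⟨hle, hmean⟩
    obtain ⟨π, h₁, h₂, h₃⟩ := exists_martingale_coupling_of_convex_order (P.map ψ) (P.map Y)
      hiψ hiY (fun y => by
        rw [integral_map hY.aemeasurable (hmax y).aestronglyMeasurable,
          integral_map hψ.aemeasurable (hmax y).aestronglyMeasurable, ← sub_nonneg, ← hsub]
        exact hle y) (by
        rw [integral_map hY.aemeasurable measurable_id'.aestronglyMeasurable,
          integral_map hψ.aemeasurable measurable_id'.aestronglyMeasurable]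
        exact hmean.symm)
    exact rationalizesRE_of_coupling hY hψ h₁ h₂ h₃
  tfae_finish
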